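/- For a real random variable $X$ whose Laplace transform $\mathbb{E}[e^{zX}]$ converges in a neighbourhood of $z=0$, let the cumulants $\kappa^{(r)}(X)$, $r\ge 1$, be defined by $\log\mathbb{E}[e^{zX}]=\sum_{r\ge 1}\frac{\kappa^{(r)}(X)}{r!}z^r$. Let $(S_n)_{n\in\mathbb{N}}$ be real random variables (each defined on its own probability space) whose Laplace transforms converge in a neighbourhood of $0$, and suppose that they have uniform bounds on cumulants with parameters $(D_n,N_n,A)$, where $D_n,N_n,A$ are real numbers: for every $n$ and every $r\ge 1$, $$|\kappa^{(r)}(S_n)|\le r^{r-2}A^r(2D_n)^{r-1}N_n .$$ Put $L_n=\frac{\mathrm{Var}(S_n)^{3/2}}{N_nD_n^2}$ and suppose that $L_n\to+\infty$ and $D_n=o(N_n)$ as $n\to\infty$. Let $Y_n=\frac{S_n-\mathbb{E}[S_n]}{\sqrt{\mathrm{Var}(S_n)}}$, and let $m$ be the Lebesgue measure on $\mathbb{R}$. Call $B\subset\mathbb{R}$ Jordan measurable if it is bounded and (Borel) measurable with $m(\partial B)=0$. Then for every $\delta\in(0,1)$, every $y\in\mathbb{R}$ and every Jordan measurable $B$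 with $m(B)>0$, $$\lim_{n\to\infty}L_n^{\delta}\;\mathbb{P}\big[Y_n-y\in L_n^{-\delta}B\big]=\frac{e^{-y^2/2}}{\sqrt{2\pi}}\,m(B).$$ If moreover $\liminf_{n\to\infty}\frac{\mathrm{Var}(S_n)}{N_nD_n}>0$, then for every $\gamma\in(0,\tfrac12)$, every $y\in\mathbb{R}$ and every Jordan measurable $B$ with $m(B)>0$, $$\lim_{n\to\infty}\Big(\frac{N_n}{D_n}\Big)^{\gamma}\;\mathbb{P}\Big[Y_n-y\in \Big(\frac{D_n}{N_n}\Big)^{\gamma}B\Big]=\frac{e^{-y^2/2}}{\sqrt{2\pi}}\,m(B).$$ -/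

import Mathlib

open MeasureTheory ProbabilityTheory Filter Topology Asymptotics
open scoped Pointwise

/-- The `r`-th cumulant of a real random variable `X`: the coefficient of `z ^ r / r!` in the
expansion at `0` of the log-Laplace transform `z ↦ log E[exp (z X)]`, that is, the `r`-th derivative
at `0` of the cumulant generating function. It is meaningful when the Laplace transform converges
in a neighbourhood of `0`. -/
noncomputable def cumulant {Ω : Type*} [MeasurableSpace Ω] (X : Ω → ℝ) (μ : Measure Ω) (r : ℕ) : ℝ :=
  iteratedDeriv r (cgf X μ) 0

/-- The random variables `S n` (on possibly different probability spaces) have uniform bounds on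
cumulants with parameters `(D n, N n, A)`: the Laplace transform of each `S n` converges in a
neighbourhood of `0`, and `|κ⁽ʳ⁾(S n)| ≤ r ^ (r - 2) * A ^ r * (2 * D n) ^ (r - 1) * N n` for all
`r ≥ 1`. -/
def HasUniformCumulantBounds {Ω : ℕ → Type*} [∀ n, MeasurableSpace (Ω n)]
    (P : ∀ n, Measure (Ω n)) (S : ∀ n, Ω n → ℝ) (D N : ℕ → ℝ) (A : ℝ) : Prop :=
  ∀ n, 0 ∈ interior (integrableExpSet (S n) (P n)) ∧
    ∀ r : ℕ, 1 ≤ r →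
      |cumulant (S n) (P n) r| ≤ (r : ℝ) ^ ((r : ℤ) - 2) * A ^ r * (2 * D n) ^ (r - 1) * N n

/-- A Jordan measurable subset of the real line: a bounded measurable set whose boundary has zero
Lebesgue measure. -/
def IsJordanMeasurable (B : Set ℝ) : Prop :=
  Bornology.IsBounded B ∧ MeasurableSet B ∧ volume (frontier B) = 0

/-- The standardisation `(X - E[X]) / √Var(X)` of a real random variable. -/
noncomputable def standardised {Ω : Type*} [MeasurableSpace Ω] (X : Ω → ℝ) (μ : Measure Ω) (ω : Ω) : ℝ :=
  (X ω - ∫ ω', X ω' ∂μ) / √(variance X μ)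

/-- The quantity `Var(S n) ^ (3/2) / (N n * (D n) ^ 2)`. -/
noncomputable def cumulantScale {Ω : ℕ → Type*} [∀ n, MeasurableSpace (Ω n)]
    (P : ∀ n, Measure (Ω n)) (S : ∀ n, Ω n → ℝ) (D N : ℕ → ℝ) (n : ℕ) : ℝ :=
  variance (S n) (P n) ^ (3 / 2 : ℝ) / (N n * D n ^ 2)

/-!
The proof is by Fourier analysis on a zone of control.

*Zone of control.* As `r ^ r / r! ≤ e ^ r`, the cumulant bounds are geometric, so the generating
series of the cumulants converges on a disc of radius of order `1 / D n`. By the identity theorem,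
its exponential is the Laplace transform of `S n` on the part of this disc lying in a vertical strip
around the imaginary axis, hence gives the characteristic function of `S n` there
(`charFun_eq_exp_tsum_cumulant`). After standardisation the cumulants of orders one and two yield
exactly `exp (-t ^ 2 / 2)`, and the remaining ones a factor `exp R` with `|R| ≤ C |t| ^ 3 / L n`, for
all `|t| ≤ L n / (4 C)` (`exists_charFun_standardised_eq_of_cumulant_bounds`). On this zone the
characteristic function of `Y n` is at most `exp (-t ^ 2 / 4)` in modulus, and it converges pointwise
to the Gaussian one.

*Local limit theorem.* Let `a n → ∞` with `a n = o(L n)`, let `ρ n` be the law of `a n * (Y n - y)`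
and let `g x = (sin (x / 2) / (x / 2)) ^ 2`, the Fourier transform of the triangle function. Since
the triangle function has compact support, the Fourier transform of the finite measure
`a n • g • ρ n` only involves the characteristic function of `Y n` at arguments `O(a n)`, which lie in
the zone of control. By dominated convergence it tends to the Fourier transform of
`c • g • Lebesgue`, where `c` is the Gaussian density at `y` (`tendsto_charFun_fejerWeighted`). By
Lévy's continuity theorem the weighted measures converge weakly; the factor `g` can be divided
out on `[-1, 1]`, and the portmanteau theorem gives the limit of `a n * ρ n B` for Jordan measurable
`B ⊆ [-1, 1]` (`tendsto_measureReal_of_fejerWeighted`), hence for all Jordan measurable `B` by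
dilation (`tendsto_local_limit`).

The two assertions are the cases `a n = L n ^ δ` and `a n = (N n / D n) ^ γ`. In the second one, a
lower bound `Var (S n) ≥ c * N n * D n` gives `L n ≥ c ^ (3/2) * (N n / D n) ^ (1/2)`, so `a n = o(L n)`.
-/


/-! ### Weak convergence of finite measures on the line -/

/-- The **Lévy continuity theorem** for finite measures with a nonzero limit: the total masses
converge by evaluating at `0`, so it reduces to the normalised measures. -/
lemma finiteMeasure_tendsto_of_tendsto_charFun {μ : ℕ → FiniteMeasure ℝ} {μ₀ : FiniteMeasure ℝ}
    (h₀ : μ₀ ≠ 0)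
    (h : ∀ t : ℝ, Tendsto (fun n ↦ charFun (μ n : Measure ℝ) t) atTop
      (𝓝 (charFun (μ₀ : Measure ℝ) t))) :
    Tendsto μ atTop (𝓝 μ₀) := by
  have hmass : Tendsto (fun n ↦ (μ n).mass) atTop (𝓝 μ₀.mass) := by
    have hre : ∀ ν : FiniteMeasure ℝ, (charFun (ν : Measure ℝ) 0).re = (ν.mass : ℝ) := fun ν ↦ by
      rw [charFun_zero]; rfl
    have h1 := (Complex.continuous_re.tendsto _).comp (h 0)
    rw [hre μ₀] at h1
    rw [← NNReal.tendsto_coe]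
    exact h1.congr fun n ↦ hre (μ n)
  have hm₀ : μ₀.mass ≠ 0 := μ₀.mass_nonzero_iff.2 h₀
  have hne : ∀ᶠ n in atTop, (μ n).mass ≠ 0 := hmass.eventually_ne hm₀
  have hnorm : ∀ (ν : FiniteMeasure ℝ) (t : ℝ), ν.mass ≠ 0 →
      charFun (ν.normalize : Measure ℝ) t =
        ((ν.mass⁻¹ : NNReal) : ℝ) * charFun (ν : Measure ℝ) t := by
    intro ν t hν
    rw [ν.toMeasure_normalize_eq_of_nonzero (ν.mass_nonzero_iff.1 hν), charFun_apply, charFun_apply,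
      integral_smul_nnreal_measure]
    simp [NNReal.smul_def]
  refine FiniteMeasure.tendsto_of_tendsto_normalize_testAgainstNN_of_tendsto_mass ?_ hmass
  refine ProbabilityMeasure.tendsto_of_tendsto_charFun fun t ↦ ?_
  rw [hnorm μ₀ t hm₀]
  refine Tendsto.congr' (f₁ := fun n ↦ (((μ n).mass⁻¹ : NNReal) : ℝ) * charFun (μ n : Measure ℝ) t)
    ?_ ?_
  · filter_upwards [hne] with n hn using (hnorm _ t hn).symm
  · refine Tendsto.mul ?_ (h t)
    have := hmass.inv₀ hm₀
    exact (Complex.continuous_ofReal.tendsto _).comp ((NNReal.continuous_coe.tendsto _).comp this)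

/-- One implication of the portmanteau theorem, for finite measures. -/
lemma finiteMeasure_tendsto_measureReal_of_null_frontier {μ : ℕ → FiniteMeasure ℝ}
    {μ₀ : FiniteMeasure ℝ} (h : Tendsto μ atTop (𝓝 μ₀)) {E : Set ℝ}
    (hE : (μ₀ : Measure ℝ) (frontier E) = 0) :
    Tendsto (fun n ↦ (μ n : Measure ℝ).real E) atTop (𝓝 ((μ₀ : Measure ℝ).real E)) := by
  suffices H : Tendsto (fun n ↦ μ n E) atTop (𝓝 (μ₀ E)) by
    exact (NNReal.continuous_coe.tendsto _).comp H
  rcases eq_or_ne μ₀ 0 with rfl | h₀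
  · have hm : Tendsto (fun n ↦ (μ n).mass) atTop (𝓝 0) := by simpa using h.mass
    simpa using tendsto_of_tendsto_of_tendsto_of_le_of_le tendsto_const_nhds hm
      (fun n ↦ zero_le (a := μ n E)) (fun n ↦ (μ n).apply_le_mass E)
  · have hn := FiniteMeasure.tendsto_normalize_of_tendsto h h₀
    have hE' : μ₀.normalize (frontier E) = 0 := by
      rw [μ₀.normalize_eq_of_nonzero h₀]
      have : μ₀ (frontier E) = 0 := by
        change ((μ₀ : Measure ℝ) (frontier E)).toNNReal = 0
        rw [hE, ENNReal.toNNReal_zero]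
      rw [this, mul_zero]
    have := ProbabilityMeasure.tendsto_measure_of_null_frontier_of_tendsto hn hE'
    simp_rw [FiniteMeasure.self_eq_mass_mul_normalize _ E]
    exact h.mass.mul this

/-! ### The Fejér kernel -/

/-- The triangle function `ξ ↦ (1 - |ξ|)⁺`. -/
noncomputable def triangle (ξ : ℝ) : ℝ := max (1 - |ξ|) 0

/-- The Fejér kernel `x ↦ (sin (x / 2) / (x / 2)) ^ 2` of the real line, without its normalising
factor: the Fourier transform of the triangle function. -/
noncomputable def fejer (x : ℝ) : ℝ := Real.sinc (x / 2) ^ 2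

lemma continuous_triangle : Continuous triangle := by unfold triangle; fun_prop

lemma continuous_fejer : Continuous fejer :=
  (Real.continuous_sinc.comp (continuous_id.div_const 2)).pow 2

lemma triangle_nonneg (ξ : ℝ) : 0 ≤ triangle ξ := le_max_right _ _

lemma triangle_le_one (ξ : ℝ) : triangle ξ ≤ 1 :=
  max_le (by linarith [abs_nonneg ξ]) zero_le_one

lemma triangle_neg (ξ : ℝ) : triangle (-ξ) = triangle ξ := by simp [triangle]

lemma triangle_zero : triangle 0 = 1 := by simp [triangle]

lemma triangle_eq_zero {ξ : ℝ} (h : 1 ≤ |ξ|) : triangle ξ = 0 := max_eq_right (by linarith)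

lemma hasCompactSupport_triangle : HasCompactSupport triangle :=
  HasCompactSupport.intro (isCompact_Icc (a := (-1 : ℝ)) (b := 1)) fun ξ hξ ↦
    triangle_eq_zero (by
      by_contra! h
      exact hξ ⟨(abs_lt.1 h).1.le, (abs_lt.1 h).2.le⟩)

lemma integrable_triangle : Integrable triangle :=
  continuous_triangle.integrable_of_hasCompactSupport hasCompactSupport_triangle

lemma fejer_nonneg (x : ℝ) : 0 ≤ fejer x := sq_nonneg _

lemma fejer_zero : fejer 0 = 1 := by simp [fejer]

lemma fejer_le_one (x : ℝ) : fejer x ≤ 1 := by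
  rw [fejer, sq_le_one_iff_abs_le_one]
  exact Real.abs_sinc_le_one _

lemma one_fourth_le_fejer {x : ℝ} (hx : |x| ≤ 1) : 1 / 4 ≤ fejer x := by
  have key : 1 / 2 ≤ Real.sinc (x / 2) := by
    rcases eq_or_ne x 0 with rfl | h0
    · norm_num
    · have hpos : 0 < |x| := abs_pos.2 h0
      have h1 : Real.sinc (x / 2) = Real.sin (|x| / 2) / (|x| / 2) := by
        rw [← Real.sinc_of_ne_zero (by positivity)]
        rcases abs_choice x with h | h <;> rw [h]
        rw [neg_div, Real.sinc_neg]
      rw [h1, le_div_iff₀ (by positivity)]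
      have h2 := Real.mul_le_sin (x := |x| / 2) (by positivity)
        (by linarith [Real.pi_gt_three])
      refine le_trans ?_ h2
      have : (1 : ℝ) / 2 ≤ 2 / Real.pi := by
        rw [div_le_div_iff₀ two_pos Real.pi_pos]; linarith [Real.pi_le_four]
      gcongr
  unfold fejer
  nlinarith

lemma fejer_le (x : ℝ) : fejer x ≤ 5 * (1 + x ^ 2)⁻¹ := by
  have h1 : fejer x * x ^ 2 ≤ 4 := by
    rcases eq_or_ne x 0 with rfl | h0
    · simp
    · have : fejer x * x ^ 2 = 4 * Real.sin (x / 2) ^ 2 := by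
        rw [fejer, Real.sinc_of_ne_zero (by simpa using h0)]
        field_simp
        ring
      rw [this]
      nlinarith [Real.sin_sq_le_one (x / 2)]
  rw [← div_eq_mul_inv, le_div_iff₀ (by positivity)]
  nlinarith [fejer_le_one x]

lemma integrable_fejer : Integrable fejer :=
  Integrable.mono' (integrable_inv_one_add_sq.const_mul 5) continuous_fejer.aestronglyMeasurable
    (.of_forall fun x ↦ by simpa [abs_of_nonneg (fejer_nonneg x)] using fejer_le x)

lemma integral_one_sub_mul_cexp {w : ℂ} (hw : w ≠ 0) :
    ∫ ξ : ℝ in (0 : ℝ)..1, (1 - (ξ : ℂ)) * Complex.exp (w * ξ) =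
      Complex.exp w / w ^ 2 - 1 / w - 1 / w ^ 2 := by
  have hd : ∀ ξ : ℝ, HasDerivAt
      (fun ξ : ℝ ↦ (1 - (ξ : ℂ)) * Complex.exp (w * ξ) / w + Complex.exp (w * ξ) / w ^ 2)
      ((1 - (ξ : ℂ)) * Complex.exp (w * ξ)) ξ := by
    intro ξ
    have h1 : HasDerivAt (fun ξ : ℝ ↦ (ξ : ℂ)) 1 ξ := Complex.ofRealCLM.hasDerivAt
    have h2 : HasDerivAt (fun ξ : ℝ ↦ Complex.exp (w * ξ)) (Complex.exp (w * ξ) * (w * 1)) ξ :=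
      (h1.const_mul w).cexp
    have h3 := ((((h1.const_sub 1).mul h2).div_const w).add (h2.div_const (w ^ 2)))
    convert! h3 using 1
    field_simp
    ring
  rw [intervalIntegral.integral_eq_sub_of_hasDerivAt (fun ξ _ ↦ hd ξ)
    (Continuous.intervalIntegrable (by fun_prop) _ _)]
  simp
  ring

/-- The Fejér kernel is the Fourier transform of the triangle function. -/
lemma integral_triangle_mul_cexp (x : ℝ) :
    ∫ ξ : ℝ, (triangle ξ : ℂ) * Complex.exp (ξ * x * Complex.I) = fejer x := by
  have hcont : ∀ x : ℝ, Continuous fun ξ : ℝ ↦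
      (triangle ξ : ℂ) * Complex.exp (ξ * x * Complex.I) := fun x ↦ by
    have := continuous_triangle; fun_prop
  have hsupp : Function.support (fun ξ : ℝ ↦ (triangle ξ : ℂ) * Complex.exp (ξ * x * Complex.I)) ⊆
      Set.Ioc (-1) 1 := by
    intro ξ hξ
    by_contra h
    refine hξ ?_
    have : 1 ≤ |ξ| := by
      by_contra! h'
      exact h ⟨(abs_lt.1 h').1, (abs_lt.1 h').2.le⟩
    simp [triangle_eq_zero this]
  have hhalf : ∀ x : ℝ, ∫ ξ : ℝ in (0 : ℝ)..1,
      (triangle ξ : ℂ) * Complex.exp (ξ * x * Complex.I) =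
      ∫ ξ : ℝ in (0 : ℝ)..1, (1 - (ξ : ℂ)) * Complex.exp (x * Complex.I * ξ) := by
    intro x
    refine intervalIntegral.integral_congr fun ξ hξ ↦ ?_
    rw [Set.uIcc_of_le zero_le_one] at hξ
    simp only [triangle, abs_of_nonneg hξ.1, max_eq_left (sub_nonneg.2 hξ.2)]
    push_cast
    ring_nf
  have hneg : ∫ ξ : ℝ in (-1 : ℝ)..0, (triangle ξ : ℂ) * Complex.exp (ξ * x * Complex.I) =
      ∫ ξ : ℝ in (0 : ℝ)..1, (triangle ξ : ℂ) * Complex.exp (ξ * (-x : ℝ) * Complex.I) := by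
    have := intervalIntegral.integral_comp_neg (a := 0) (b := 1)
      (fun ξ : ℝ ↦ (triangle ξ : ℂ) * Complex.exp (ξ * x * Complex.I))
    simp only [neg_zero] at this
    rw [← this]
    refine intervalIntegral.integral_congr fun ξ _ ↦ ?_
    simp only [triangle_neg]
    push_cast
    ring_nf
  -- The two halves of the triangle contribute the values at `x` and at `-x` of one integral.
  rw [← intervalIntegral.integral_eq_integral_of_support_subset hsupp,
    ← intervalIntegral.integral_add_adjacent_intervals (b := 0)
      ((hcont x).intervalIntegrable _ _) ((hcont x).intervalIntegrable _ _), hneg, hhalf, hhalf]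
  rcases eq_or_ne x 0 with rfl | hx
  · have : ∫ ξ : ℝ in (0 : ℝ)..1, (1 - (ξ : ℂ)) = 1 / 2 := by
      have h : (fun ξ : ℝ ↦ (1 - (ξ : ℂ))) = fun ξ : ℝ ↦ ((1 - ξ : ℝ) : ℂ) := by ext; simp
      rw [h, intervalIntegral.integral_ofReal, intervalIntegral.integral_sub (by simp) (by simp)]
      norm_num
    simp [this, fejer_zero]
    norm_num
  · have hxI : ((x : ℝ) : ℂ) * Complex.I ≠ 0 := by simp [hx]
    have hxI' : ((-x : ℝ) : ℂ) * Complex.I ≠ 0 := by simp [hx]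
    rw [integral_one_sub_mul_cexp hxI, integral_one_sub_mul_cexp hxI']
    have hc : Complex.exp (((x : ℝ) : ℂ) * Complex.I) + Complex.exp (((-x : ℝ) : ℂ) * Complex.I) =
        2 - 4 * Complex.sin ((x : ℂ) / 2) ^ 2 := by
      have h2 := Complex.two_cos (x : ℂ)
      push_cast
      rw [← h2]
      have h3 : Complex.cos (x : ℂ) = 1 - 2 * Complex.sin ((x : ℂ) / 2) ^ 2 := by
        have := Complex.cos_two_mul ((x : ℂ) / 2)
        rw [mul_div_cancel₀ _ (two_ne_zero)] at this
        rw [this, Complex.cos_sq']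
        ring
      rw [h3]; ring
    have hx0 : (x : ℂ) ≠ 0 := by exact_mod_cast hx
    have hF : (fejer x : ℂ) = 4 * Complex.sin ((x : ℂ) / 2) ^ 2 / (x : ℂ) ^ 2 := by
      rw [fejer, Real.sinc_of_ne_zero (by simpa using hx)]
      push_cast
      field_simp
      ring
    have hI : ∀ z : ℂ, (z * Complex.I) ^ 2 = - z ^ 2 := fun z ↦ by
      rw [mul_pow, Complex.I_sq]; ring
    rw [hI, hI, hF]
    push_cast at hc ⊢
    rw [eq_sub_iff_add_eq] at hc
    have e1 : 1 / (-(x : ℂ) * Complex.I) = - (1 / ((x : ℂ) * Complex.I)) := by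
      rw [neg_mul, one_div, inv_neg, one_div]
    rw [e1]
    have e2 : ∀ E₁ E₂ w : ℂ, E₁ / -(x : ℂ) ^ 2 - w - 1 / -(x : ℂ) ^ 2 +
        (E₂ / -(x : ℂ) ^ 2 - -w - 1 / -(x : ℂ) ^ 2) = (2 - (E₁ + E₂)) / (x : ℂ) ^ 2 := fun _ _ _ ↦ by
      field_simp; ring
    rw [neg_sq, add_comm, e2]
    congr 1
    linear_combination -hc

open FourierTransform in
/-- Fourier inversion for the Fejér kernel. -/
lemma integral_fejer_mul_cexp (t : ℝ) :
    ∫ x : ℝ, (fejer x : ℂ) * Complex.exp (t * x * Complex.I) = 2 * Real.pi * triangle t := by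
  set f : ℝ → ℂ := fun ξ ↦ (triangle ξ : ℂ) with hf
  -- With the normalisation `exp (-2πi ξ w)` of `𝓕`, the kernel appears at the argument `-2π w`.
  have hF : 𝓕 f = fun w ↦ (fejer ((-2 * Real.pi) * w) : ℂ) := by
    ext w
    rw [Real.fourier_eq', ← integral_triangle_mul_cexp]
    refine integral_congr_ae (.of_forall fun ξ ↦ ?_)
    simp only [hf, smul_eq_mul, RCLike.inner_apply, conj_trivial]
    rw [mul_comm]
    push_cast
    ring_nf
  have hint : Integrable (𝓕 f) := by
    rw [hF]
    exact (integrable_fejer.comp_mul_left' (by simp [Real.pi_ne_zero])).ofReal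
  have hinv := congrFun (Continuous.fourierInv_fourier_eq (f := f)
    (Complex.continuous_ofReal.comp continuous_triangle) integrable_triangle.ofReal hint) (-t)
  rw [hF, Real.fourierInv_eq'] at hinv
  have hsub := Measure.integral_comp_mul_left
    (fun x : ℝ ↦ (fejer x : ℂ) * Complex.exp (t * x * Complex.I)) (-2 * Real.pi)
  have h2 : ∫ w : ℝ, (fejer ((-2 * Real.pi) * w) : ℂ) *
      Complex.exp (t * ((-2 * Real.pi) * w : ℝ) * Complex.I) = triangle t := by
    rw [← triangle_neg, ← show f (-t) = (triangle (-t) : ℂ) from rfl, ← hinv]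
    refine integral_congr_ae (.of_forall fun w ↦ ?_)
    simp only [smul_eq_mul, RCLike.inner_apply, conj_trivial]
    rw [mul_comm]
    push_cast
    ring_nf
  rw [h2] at hsub
  rw [hsub]
  have hpi : (Real.pi : ℂ) ≠ 0 := by exact_mod_cast Real.pi_ne_zero
  have habs : |(-2 * Real.pi)⁻¹| = (2 * Real.pi)⁻¹ := by
    rw [abs_inv, abs_mul]; simp [abs_of_pos Real.pi_pos]
  rw [habs, Complex.real_smul]
  push_cast
  rw [mul_inv_cancel_left₀ (by simp [hpi])]

/-! ### From characteristic functions to a local limit theorem -/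

/-- Integrals of the Fejér kernel only see the characteristic function on a bounded window: Parseval's
formula, obtained by writing the kernel as a Fourier transform and exchanging the integrals. -/
lemma integral_fejer_mul_cexp_eq_integral_charFun (ρ : Measure ℝ) [IsProbabilityMeasure ρ] (t : ℝ) :
    ∫ x : ℝ, (fejer x : ℂ) * Complex.exp (t * x * Complex.I) ∂ρ =
      ∫ ξ : ℝ, (triangle ξ : ℂ) * charFun ρ (ξ + t) := by
  have hint : Integrable (Function.uncurry fun x ξ : ℝ ↦
      (triangle ξ : ℂ) * Complex.exp ((ξ + t : ℝ) * x * Complex.I)) (ρ.prod volume) := by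
    have h1 : Integrable (fun p : ℝ × ℝ ↦ triangle p.2) (ρ.prod volume) :=
      integrable_triangle.comp_snd ρ
    refine h1.mono' ?_ (.of_forall fun p ↦ ?_)
    · have := continuous_triangle
      exact Continuous.aestronglyMeasurable (by unfold Function.uncurry; fun_prop)
    · have : ((p.2 + t : ℝ) * p.1 * Complex.I : ℂ) = (((p.2 + t) * p.1 : ℝ) : ℂ) * Complex.I := by
        push_cast; ring
      simp only [Function.uncurry]
      rw [norm_mul, this, Complex.norm_exp_ofReal_mul_I, mul_one, Complex.norm_real,
        Real.norm_of_nonneg (triangle_nonneg _)]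
  have hswap := integral_integral_swap hint
  calc ∫ x : ℝ, (fejer x : ℂ) * Complex.exp (t * x * Complex.I) ∂ρ
      = ∫ x : ℝ, (∫ ξ : ℝ, (triangle ξ : ℂ) * Complex.exp ((ξ + t : ℝ) * x * Complex.I)) ∂ρ := by
        refine integral_congr_ae (.of_forall fun x ↦ ?_)
        simp only
        rw [← integral_triangle_mul_cexp, ← integral_mul_const]
        refine integral_congr_ae (.of_forall fun ξ ↦ ?_)
        simp only
        rw [mul_assoc, ← Complex.exp_add]
        push_cast
        ring_nf
    _ = ∫ ξ : ℝ, (triangle ξ : ℂ) * charFun ρ (ξ + t) := by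
        rw [hswap]
        refine integral_congr_ae (.of_forall fun ξ ↦ ?_)
        simp only
        rw [charFun_apply_real, integral_const_mul]

lemma charFun_map_mul_sub (ν : Measure ℝ) (a y s : ℝ) :
    charFun (ν.map fun x ↦ a * (x - y)) s =
      charFun ν (a * s) * Complex.exp (-(a * s * y : ℝ) * Complex.I) := by
  rw [charFun_apply_real, charFun_apply_real, integral_map (by fun_prop)
    (Continuous.aestronglyMeasurable (by fun_prop)), ← integral_mul_const]
  refine integral_congr_ae (.of_forall fun x ↦ ?_)
  simp only
  rw [← Complex.exp_add]
  push_cast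
  ring_nf

/-- The measure `a • g • ρ`, where `g` is the Fejér kernel; the weight makes it finite even for
infinite `ρ` such as Lebesgue measure. -/
noncomputable def fejerWeighted (a : ℝ) (ρ : Measure ℝ) : Measure ℝ :=
  ρ.withDensity fun x ↦ ENNReal.ofReal (a * fejer x)

lemma isFiniteMeasure_fejerWeighted {a : ℝ} {ρ : Measure ℝ} (h : Integrable fejer ρ) :
    IsFiniteMeasure (fejerWeighted a ρ) := by
  refine isFiniteMeasure_withDensity_ofReal ?_
  exact (h.const_mul a).2

lemma integral_fejerWeighted {a : ℝ} (ha : 0 ≤ a) (ρ : Measure ℝ) (f : ℝ → ℂ) :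
    ∫ x, f x ∂(fejerWeighted a ρ) = a * ∫ x, fejer x * f x ∂ρ := by
  have hm : Measurable fun x ↦ ENNReal.ofReal (a * fejer x) :=
    (continuous_fejer.measurable.const_mul a).ennreal_ofReal
  rw [fejerWeighted, integral_withDensity_eq_integral_toReal_smul hm
    (.of_forall fun _ ↦ ENNReal.ofReal_lt_top), ← integral_const_mul]
  refine integral_congr_ae (.of_forall fun x ↦ ?_)
  simp only
  rw [ENNReal.toReal_ofReal (mul_nonneg ha (fejer_nonneg x)), Complex.real_smul]
  push_cast
  ring

lemma charFun_fejerWeighted_map {a : ℝ} (ha : 0 < a) (ν : Measure ℝ) [IsProbabilityMeasure ν]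
    (y t : ℝ) :
    charFun (fejerWeighted a (ν.map fun x ↦ a * (x - y))) t =
      ∫ u : ℝ, (triangle (a⁻¹ * u - t) : ℂ) *
        (charFun ν u * Complex.exp (-(u * y : ℝ) * Complex.I)) := by
  have : IsProbabilityMeasure (ν.map fun x ↦ a * (x - y)) :=
    Measure.isProbabilityMeasure_map (by fun_prop)
  rw [charFun_apply_real, integral_fejerWeighted ha.le,
    integral_fejer_mul_cexp_eq_integral_charFun]
  simp_rw [charFun_map_mul_sub]
  set G : ℝ → ℂ := fun u ↦ (triangle (a⁻¹ * u - t) : ℂ) *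
        (charFun ν u * Complex.exp (-(u * y : ℝ) * Complex.I)) with hG
  have h1 := Measure.integral_comp_mul_left G a
  have h2 := integral_add_right_eq_self (μ := volume) (fun ξ ↦ G (a * ξ)) t
  rw [h1] at h2
  have h3 : ∀ ξ : ℝ, (triangle ξ : ℂ) * (charFun ν (a * (ξ + t)) *
      Complex.exp (-(a * (ξ + t) * y : ℝ) * Complex.I)) = G (a * (ξ + t)) := by
    intro ξ
    simp only [hG]
    rw [inv_mul_cancel_left₀ ha.ne', add_sub_cancel_right]
  simp_rw [h3]
  rw [h2, abs_of_pos (inv_pos.2 ha), Complex.real_smul]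
  push_cast
  rw [mul_inv_cancel_left₀ (by exact_mod_cast ha.ne')]

lemma integral_gaussian_mul_cexp (y : ℝ) :
    ∫ u : ℝ, Complex.exp (-(u : ℂ) ^ 2 / 2) * Complex.exp (-(u * y : ℝ) * Complex.I) =
      (√(2 * Real.pi) * Real.exp (-y ^ 2 / 2) : ℝ) := by
  have h := fourierIntegral_gaussian (b := 1 / 2) (by norm_num) (-y : ℂ)
  have e : ∀ u : ℝ, Complex.exp (-(u : ℂ) ^ 2 / 2) * Complex.exp (-(u * y : ℝ) * Complex.I) =
      Complex.exp (Complex.I * (-y : ℂ) * u) * Complex.exp (-(1 / 2) * (u : ℂ) ^ 2) := fun u ↦ by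
    rw [← Complex.exp_add, ← Complex.exp_add]
    push_cast
    ring_nf
  simp_rw [e]
  rw [h]
  have h1 : ((Real.pi : ℂ) / (1 / 2)) ^ (1 / 2 : ℂ) = (√(2 * Real.pi) : ℝ) := by
    rw [Real.sqrt_eq_rpow, Complex.ofReal_cpow (by positivity)]
    push_cast
    ring_nf
  rw [h1]
  push_cast
  ring_nf

/-- The density at `y` of the standard Gaussian distribution. -/
noncomputable def gaussianDensity (y : ℝ) : ℝ := Real.exp (-y ^ 2 / 2) / √(2 * Real.pi)

lemma gaussianDensity_pos (y : ℝ) : 0 < gaussianDensity y := by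
  unfold gaussianDensity; positivity

lemma charFun_fejerWeighted_volume (y t : ℝ) :
    charFun (fejerWeighted (gaussianDensity y) volume) t =
      triangle t * (√(2 * Real.pi) * Real.exp (-y ^ 2 / 2) : ℝ) := by
  rw [charFun_apply_real, integral_fejerWeighted (gaussianDensity_pos y).le,
    integral_fejer_mul_cexp, gaussianDensity]
  have h2 : (√(2 * Real.pi) : ℂ) ^ 2 = 2 * Real.pi := by
    have := Real.sq_sqrt (x := 2 * Real.pi) (by positivity)
    exact_mod_cast congrArg (fun x : ℝ ↦ (x : ℂ)) this
  have h3 : (√(2 * Real.pi) : ℂ) ≠ 0 := by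
    exact_mod_cast (show √(2 * Real.pi) ≠ 0 by positivity)
  rw [← h2]
  push_cast
  field_simp

/-- The analytic core: rescaled by `a n`, only the values of the characteristic function on a zone
of size `O(a n)` matter, and there they are dominated by a fixed Gaussian. -/
lemma tendsto_charFun_fejerWeighted {ν : ℕ → Measure ℝ} [∀ n, IsProbabilityMeasure (ν n)]
    {a : ℕ → ℝ} (ha : Tendsto a atTop atTop)
    (hlim : ∀ t : ℝ, Tendsto (fun n ↦ charFun (ν n) t) atTop (𝓝 (Complex.exp (-(t : ℂ) ^ 2 / 2))))
    (hbound : ∀ M : ℝ, ∀ᶠ n in atTop, ∀ t : ℝ, |t| ≤ M * a n →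
      ‖charFun (ν n) t‖ ≤ Real.exp (-t ^ 2 / 4)) (y t : ℝ) :
    Tendsto (fun n ↦ charFun (fejerWeighted (a n) ((ν n).map fun x ↦ a n * (x - y))) t) atTop
      (𝓝 (charFun (fejerWeighted (gaussianDensity y) volume) t)) := by
  have hpos : ∀ᶠ n in atTop, 0 < a n := ha.eventually_gt_atTop 0
  rw [charFun_fejerWeighted_volume, ← integral_gaussian_mul_cexp, ← integral_const_mul]
  refine Tendsto.congr' (hpos.mono fun n hn ↦ (charFun_fejerWeighted_map hn (ν n) y t).symm) ?_
  have hexp : ∀ u : ℝ, ‖Complex.exp (-(u * y : ℝ) * Complex.I)‖ = 1 := fun u ↦ by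
    rw [← Complex.ofReal_neg, Complex.norm_exp_ofReal_mul_I]
  refine tendsto_integral_filter_of_dominated_convergence (fun u ↦ Real.exp (-(1 / 4) * u ^ 2))
    ?_ ?_ (integrable_exp_neg_mul_sq (by norm_num)) ?_
  · refine .of_forall fun n ↦ Continuous.aestronglyMeasurable ?_
    have := continuous_triangle
    have : Continuous (charFun (ν n)) := by fun_prop
    fun_prop
  · filter_upwards [hpos, hbound (1 + |t|)] with n hn hb
    refine .of_forall fun u ↦ ?_
    rw [norm_mul, norm_mul, hexp, mul_one, Complex.norm_real, Real.norm_of_nonneg (triangle_nonneg _)]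
    by_cases h : |u| ≤ (1 + |t|) * a n
    · calc _ ≤ 1 * Real.exp (-u ^ 2 / 4) :=
            mul_le_mul (triangle_le_one _) (hb u h) (norm_nonneg _) zero_le_one
        _ = _ := by ring_nf
    · -- outside the zone the triangle function vanishes
      have : 1 ≤ |(a n)⁻¹ * u - t| := by
        push Not at h
        have h1 : 1 + |t| ≤ |(a n)⁻¹ * u| := by
          rw [abs_mul, abs_of_pos (inv_pos.2 hn), ← div_eq_inv_mul, le_div_iff₀ hn]
          exact h.le
        linarith [abs_sub_abs_le_abs_sub ((a n)⁻¹ * u) t]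
      rw [triangle_eq_zero this, zero_mul]
      positivity
  · refine .of_forall fun u ↦ Tendsto.mul ?_ ((hlim u).mul_const _)
    have h1 : Tendsto (fun n ↦ (a n)⁻¹ * u - t) atTop (𝓝 (-t)) := by
      simpa using ((tendsto_inv_atTop_zero.comp ha).mul_const u).sub_const t
    have h2 := (continuous_triangle.tendsto (-t)).comp h1
    rw [triangle_neg] at h2
    exact (Complex.continuous_ofReal.tendsto _).comp h2

/-- Weak convergence is stable under multiplication by a bounded continuous density. -/
lemma tendsto_withDensity_measureReal {μ : ℕ → FiniteMeasure ℝ} {μ₀ : FiniteMeasure ℝ}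
    (h : Tendsto μ atTop (𝓝 μ₀)) (w : BoundedContinuousFunction ℝ ℝ) (hw : ∀ x, 0 ≤ w x)
    {E : Set ℝ} (hE : (μ₀ : Measure ℝ) (frontier E) = 0) :
    Tendsto (fun n ↦ ((μ n : Measure ℝ).withDensity fun x ↦ ENNReal.ofReal (w x)).real E) atTop
      (𝓝 (((μ₀ : Measure ℝ).withDensity fun x ↦ ENNReal.ofReal (w x)).real E)) := by
  have hfin : ∀ ν : FiniteMeasure ℝ,
      IsFiniteMeasure ((ν : Measure ℝ).withDensity fun x ↦ ENNReal.ofReal (w x)) := fun ν ↦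
    isFiniteMeasure_withDensity_ofReal (w.integrable (ν : Measure ℝ)).2
  let κ : FiniteMeasure ℝ → FiniteMeasure ℝ := fun ν ↦ ⟨_, hfin ν⟩
  have hint : ∀ (ν : FiniteMeasure ℝ) (f : BoundedContinuousFunction ℝ ℝ),
      ∫ x, f x ∂(κ ν : Measure ℝ) = ∫ x, (w * f) x ∂(ν : Measure ℝ) := fun ν f ↦ by
    change ∫ x, f x ∂((ν : Measure ℝ).withDensity fun x ↦ ENNReal.ofReal (w x)) = _
    rw [integral_withDensity_eq_integral_toReal_smul
      (w.continuous.measurable.ennreal_ofReal) (.of_forall fun _ ↦ ENNReal.ofReal_lt_top)]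
    refine integral_congr_ae (.of_forall fun x ↦ ?_)
    simp [ENNReal.toReal_ofReal (hw x)]
  refine finiteMeasure_tendsto_measureReal_of_null_frontier (μ := fun n ↦ κ (μ n)) (μ₀ := κ μ₀) ?_
    (withDensity_absolutelyContinuous _ _ hE)
  refine FiniteMeasure.tendsto_of_forall_integral_tendsto fun f ↦ ?_
  simp_rw [hint]
  exact FiniteMeasure.tendsto_iff_forall_integral_tendsto.1 h (w * f)

/-- Dividing by the Fejér kernel, which is bounded below on `[-1, 1]`, turns weak convergence of the
weighted measures into convergence of the masses of subsets of `[-1, 1]`. -/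
lemma tendsto_measureReal_of_fejerWeighted {ρ : ℕ → Measure ℝ} [∀ n, IsProbabilityMeasure (ρ n)]
    {a : ℕ → ℝ} (ha : ∀ᶠ n in atTop, 0 < a n) {c : ℝ} (hc : 0 < c)
    (h : ∀ t : ℝ, Tendsto (fun n ↦ charFun (fejerWeighted (a n) (ρ n)) t) atTop
      (𝓝 (charFun (fejerWeighted c volume) t)))
    {B : Set ℝ} (hB : B ⊆ Set.Icc (-1) 1) (hBm : MeasurableSet B) (hBf : volume (frontier B) = 0) :
    Tendsto (fun n ↦ a n * (ρ n).real B) atTop (𝓝 (c * volume.real B)) := by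
  have hfin : ∀ n, IsFiniteMeasure (fejerWeighted (a n) (ρ n)) := fun n ↦
    isFiniteMeasure_fejerWeighted <| Integrable.mono' (integrable_const 1)
      continuous_fejer.aestronglyMeasurable
      (.of_forall fun x ↦ by simpa [abs_of_nonneg (fejer_nonneg x)] using fejer_le_one x)
  have hfin₀ : IsFiniteMeasure (fejerWeighted c volume) :=
    isFiniteMeasure_fejerWeighted integrable_fejer
  let μ : ℕ → FiniteMeasure ℝ := fun n ↦ ⟨fejerWeighted (a n) (ρ n), hfin n⟩
  let μ₀ : FiniteMeasure ℝ := ⟨fejerWeighted c volume, hfin₀⟩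
  have hμ : Tendsto μ atTop (𝓝 μ₀) := by
    -- The limit is nonzero, its mass being `2π c`.
    refine finiteMeasure_tendsto_of_tendsto_charFun (fun h₀ ↦ ?_) h
    have h1 : fejerWeighted c volume = 0 := congrArg Subtype.val h₀
    have h2 : charFun (fejerWeighted c volume) 0 = c * (2 * Real.pi) := by
      rw [charFun_apply_real, integral_fejerWeighted hc.le, integral_fejer_mul_cexp, triangle_zero]
      simp
    rw [h1] at h2
    have : (c : ℂ) * (2 * Real.pi) = 0 := by rw [← h2]; simp
    have : c * (2 * Real.pi) = 0 := by exact_mod_cast this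
    exact absurd this (by positivity)
  -- The maximum with `1 / 4` makes the inverse kernel bounded on the line, without changing it on
  -- `[-1, 1]`.
  have hwpos : ∀ x, (1 / 4 : ℝ) ≤ max (fejer x) (1 / 4) := fun x ↦ le_max_right _ _
  let w : BoundedContinuousFunction ℝ ℝ := BoundedContinuousFunction.ofNormedAddCommGroup
    (fun x ↦ (max (fejer x) (1 / 4))⁻¹)
    ((continuous_fejer.max continuous_const).inv₀ fun x ↦ by linarith [hwpos x]) 4 fun x ↦ by
      rw [norm_inv, Real.norm_of_nonneg (by linarith [hwpos x])]
      exact inv_le_of_inv_le₀ (by norm_num) (by linarith [hwpos x])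
  have hw : ∀ x, w x = (max (fejer x) (1 / 4))⁻¹ := fun _ ↦ rfl
  have hw0 : ∀ x, 0 ≤ w x := fun x ↦ by rw [hw]; exact inv_nonneg.2 (by linarith [hwpos x])
  have hval : ∀ (b : ℝ) (σ : Measure ℝ), 0 ≤ b →
      ((fejerWeighted b σ).withDensity fun x ↦ ENNReal.ofReal (w x)).real B = b * σ.real B := by
    intro b σ hb
    rw [Measure.real, withDensity_apply _ hBm, fejerWeighted,
      setLIntegral_withDensity_eq_setLIntegral_mul _
        (continuous_fejer.measurable.const_mul b).ennreal_ofReal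
        w.continuous.measurable.ennreal_ofReal hBm]
    have : ∀ x ∈ B, ((fun x ↦ ENNReal.ofReal (b * fejer x)) * fun x ↦ ENNReal.ofReal (w x)) x =
        ENNReal.ofReal b := by
      intro x hx
      have hx4 := one_fourth_le_fejer (abs_le.2 (hB hx))
      rw [Pi.mul_apply, ← ENNReal.ofReal_mul (mul_nonneg hb (fejer_nonneg x)), hw, max_eq_left hx4,
        mul_inv_cancel_right₀ (by linarith)]
    rw [setLIntegral_congr_fun hBm this, setLIntegral_const, ENNReal.toReal_mul,
      ENNReal.toReal_ofReal hb, Measure.real]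
  have hlim := tendsto_withDensity_measureReal hμ w hw0 (E := B)
    (withDensity_absolutelyContinuous _ _ hBf)
  change Tendsto _ _
    (𝓝 (((fejerWeighted c volume).withDensity fun x ↦ ENNReal.ofReal (w x)).real B)) at hlim
  rw [hval c volume hc.le] at hlim
  exact hlim.congr' (ha.mono fun n hn ↦ hval _ _ hn.le)

/-- Jordan measurability is invariant under dilations. -/
lemma IsJordanMeasurable.smul {B : Set ℝ} (hB : IsJordanMeasurable B) {r : ℝ} (hr : r ≠ 0) :
    IsJordanMeasurable (r • B) := by
  refine ⟨hB.1.smul₀ r, hB.2.1.const_smul₀ r, ?_⟩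
  have : frontier (r • B) = r • frontier B :=
    ((Homeomorph.smulOfNeZero r hr).image_frontier B).symm
  rw [this, Measure.addHaar_smul, hB.2.2, mul_zero]

/-- A local limit theorem: if the characteristic functions converge to the Gaussian one and are
dominated by a Gaussian on zones `|t| ≤ M * a n`, then the local limit theorem holds at the
scale `1 / a n`. -/
theorem tendsto_local_limit {ν : ℕ → Measure ℝ} [∀ n, IsProbabilityMeasure (ν n)]
    {a : ℕ → ℝ} (ha : Tendsto a atTop atTop)
    (hlim : ∀ t : ℝ, Tendsto (fun n ↦ charFun (ν n) t) atTop (𝓝 (Complex.exp (-(t : ℂ) ^ 2 / 2))))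
    (hbound : ∀ M : ℝ, ∀ᶠ n in atTop, ∀ t : ℝ, |t| ≤ M * a n →
      ‖charFun (ν n) t‖ ≤ Real.exp (-t ^ 2 / 4)) (y : ℝ) {B : Set ℝ} (hB : IsJordanMeasurable B) :
    Tendsto (fun n ↦ a n * (ν n).real {x | x - y ∈ (a n)⁻¹ • B}) atTop
      (𝓝 (gaussianDensity y * volume.real B)) := by
  -- The dilation by `η` moves `B` into `[-1, 1]`.
  obtain ⟨R, hR0, hR⟩ := hB.1.exists_pos_norm_le
  set η : ℝ := R⁻¹ with hη
  have hη0 : 0 < η := inv_pos.2 hR0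
  have hJ := hB.smul hη0.ne'
  have hsub : η • B ⊆ Set.Icc (-1) 1 := by
    rintro _ ⟨x, hx, rfl⟩
    rw [Set.mem_Icc, ← abs_le]
    simp only [smul_eq_mul, abs_mul, abs_of_pos hη0]
    rw [hη, inv_mul_le_iff₀ hR0, mul_one]
    exact hR x hx
  have ha' : Tendsto (fun n ↦ η * a n) atTop atTop := ha.const_mul_atTop hη0
  have hbound' : ∀ M : ℝ, ∀ᶠ n in atTop, ∀ t : ℝ, |t| ≤ M * (η * a n) →
      ‖charFun (ν n) t‖ ≤ Real.exp (-t ^ 2 / 4) := fun M ↦ by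
    simpa only [mul_assoc] using hbound (M * η)
  have hprob : ∀ n, IsProbabilityMeasure ((ν n).map fun x ↦ η * a n * (x - y)) := fun n ↦
    Measure.isProbabilityMeasure_map (by fun_prop)
  have key := tendsto_measureReal_of_fejerWeighted (ha'.eventually_gt_atTop 0)
    (gaussianDensity_pos y) (tendsto_charFun_fejerWeighted ha' hlim hbound' y) hsub hJ.2.1 hJ.2.2
  have key' := key.const_mul η⁻¹
  have hvol : volume.real (η • B) = η * volume.real B := by
    rw [Measure.real, Measure.addHaar_smul]
    simp [abs_of_pos hη0, Measure.real, hη0.le]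
  rw [hvol, show η⁻¹ * (gaussianDensity y * (η * volume.real B)) =
    gaussianDensity y * volume.real B by field_simp] at key'
  refine key'.congr' ?_
  filter_upwards [ha.eventually_gt_atTop 0] with n hn
  rw [map_measureReal_apply (by fun_prop) hJ.2.1, mul_assoc, inv_mul_cancel_left₀ hη0.ne']
  congr 2
  ext x
  simp only [Set.mem_preimage, Set.mem_ofPred_eq]
  rw [mul_assoc, ← smul_eq_mul, Set.smul_mem_smul_set_iff₀ hη0.ne',
    Set.mem_inv_smul_set_iff₀ hn.ne', smul_eq_mul]

/-! ### Characteristic functions from cumulants -/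

section Cumulants

variable {Ω : Type*} [MeasurableSpace Ω] {X : Ω → ℝ} {μ : Measure Ω}

lemma cumulant_zero [IsProbabilityMeasure μ] : cumulant X μ 0 = 0 := by simp [cumulant]

lemma cumulant_one [IsProbabilityMeasure μ] (h : 0 ∈ interior (integrableExpSet X μ)) :
    cumulant X μ 1 = ∫ ω, X ω ∂μ := by
  rw [cumulant, iteratedDeriv_one, deriv_cgf_zero h]
  simp

lemma cumulant_two [IsProbabilityMeasure μ] (h : 0 ∈ interior (integrableExpSet X μ)) :
    cumulant X μ 2 = variance X μ := by
  rw [cumulant, iteratedDeriv_two_cgf h, deriv_cgf_zero h,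
    variance_eq_sub (memLp_of_mem_interior_integrableExpSet h 2)]
  simp

lemma norm_cumulant_term_le [IsProbabilityMeasure μ] {K q : ℝ} (hK : 0 ≤ K)
    (hb : ∀ r : ℕ, 1 ≤ r → |cumulant X μ r / r.factorial| ≤ K * q ^ r) (r : ℕ) (z : ℂ) :
    ‖((cumulant X μ r / r.factorial : ℝ) : ℂ) * z ^ r‖ ≤ K * (q * ‖z‖) ^ r := by
  rw [norm_mul, norm_pow, Complex.norm_real, Real.norm_eq_abs]
  rcases Nat.eq_zero_or_pos r with rfl | hr
  · simpa [cumulant_zero] using hK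
  · rw [mul_pow, ← mul_assoc]
    gcongr
    exact hb r hr

/-- If the cumulants are bounded by those of a convergent power series of radius `1 / q`, the
exponential of their generating series equals the characteristic function on the whole zone
`|t| < 1 / q`, by the identity theorem on the intersection of a disc and a vertical strip. -/
theorem charFun_eq_exp_tsum_cumulant [IsProbabilityMeasure μ] (hX : AEMeasurable X μ)
    (h0 : 0 ∈ interior (integrableExpSet X μ)) {K q : ℝ} (hK : 0 ≤ K) (hq : 0 < q)
    (hb : ∀ r : ℕ, 1 ≤ r → |cumulant X μ r / r.factorial| ≤ K * q ^ r) {t : ℝ} (ht : q * |t| < 1) :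
    charFun (μ.map X) t =
      Complex.exp (∑' r : ℕ, ((cumulant X μ r / r.factorial : ℝ) : ℂ) * (t * Complex.I) ^ r) := by
  set c : ℕ → ℂ := fun r ↦ ((cumulant X μ r / r.factorial : ℝ) : ℂ) with hc
  obtain ⟨ρ, hρ1, hρ2⟩ : ∃ ρ, |t| < ρ ∧ ρ < q⁻¹ := exists_between (by
    rwa [← one_div, lt_div_iff₀ hq, mul_comm])
  have hρ0 : 0 < ρ := (abs_nonneg t).trans_lt hρ1
  have hqρ : q * ρ < 1 := by rwa [← one_div, lt_div_iff₀ hq, mul_comm] at hρ2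
  have hF : DifferentiableOn ℂ (fun z ↦ ∑' r, c r * z ^ r) (Metric.ball 0 ρ) := by
    refine Complex.differentiableOn_tsum_of_summable_norm (u := fun r ↦ K * (q * ρ) ^ r)
      ((summable_geometric_of_lt_one (by positivity) hqρ).mul_left _)
      (fun r ↦ by fun_prop) Metric.isOpen_ball fun r z hz ↦ ?_
    refine (norm_cumulant_term_le hK hb r z).trans ?_
    rw [mem_ball_zero_iff] at hz
    gcongr
  set U : Set ℂ := Metric.ball 0 ρ ∩ {z | z.re ∈ interior (integrableExpSet X μ)} with hU
  have hUpre : IsPreconnected U := by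
    refine Convex.isPreconnected ((convex_ball _ _).inter ?_)
    exact convex_integrableExpSet.interior.linear_preimage Complex.reLm
  have hE : AnalyticOnNhd ℂ (fun z ↦ Complex.exp (∑' r, c r * z ^ r)) U :=
    (hF.cexp.analyticOnNhd Metric.isOpen_ball).mono Set.inter_subset_left
  have hM : AnalyticOnNhd ℂ (complexMGF X μ) U :=
    analyticOnNhd_complexMGF.mono Set.inter_subset_right
  have hreal : ∀ᶠ x : ℝ in 𝓝 0, complexMGF X μ x = Complex.exp (∑' r, c r * (x : ℂ) ^ r) := by
    filter_upwards [(analyticAt_cgf h0).hasFPowerSeriesAt.eventually_hasSum,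
      isOpen_interior.mem_nhds h0] with x hx hxI
    have hs : HasSum (fun r ↦ c r * (x : ℂ) ^ r) (cgf X μ x : ℂ) := by
      rw [zero_add] at hx
      convert! Complex.hasSum_ofReal.2 hx using 2 with r
      simp [hc, cumulant, mul_comm]
    rw [hs.tsum_eq, complexMGF_ofReal, ← exp_cgf (interior_subset (s := integrableExpSet X μ) hxI)]
    push_cast
    rfl
  have hfreq : ∃ᶠ z : ℂ in 𝓝[≠] 0,
      complexMGF X μ z = Complex.exp (∑' r, c r * z ^ r) := by
    have htend : Tendsto (fun x : ℝ ↦ (x : ℂ)) (𝓝[≠] 0) (𝓝[≠] 0) := by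
      refine tendsto_nhdsWithin_iff.2 ⟨?_, ?_⟩
      · exact (Complex.continuous_ofReal.tendsto' 0 0 (by simp)).mono_left nhdsWithin_le_nhds
      · filter_upwards [self_mem_nhdsWithin] with x hx using by simpa using hx
    exact htend.frequently (hreal.filter_mono nhdsWithin_le_nhds).frequently
  have h0U : (0 : ℂ) ∈ U := ⟨Metric.mem_ball_self hρ0, by simpa using h0⟩
  have heq := hM.eqOn_of_preconnected_of_frequently_eq hE hUpre h0U hfreq
  have htU : (t : ℂ) * Complex.I ∈ U := ⟨by simpa using hρ1, by simpa using h0⟩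
  rw [← complexMGF_mul_I hX]
  exact heq htU

lemma charFun_map_standardised (hX : AEMeasurable X μ) (t : ℝ) :
    charFun (μ.map (standardised X μ)) t = charFun (μ.map X) (t / √(variance X μ)) *
      Complex.exp (-((t / √(variance X μ)) * ∫ ω, X ω ∂μ : ℝ) * Complex.I) := by
  have hY : AEMeasurable (standardised X μ) μ := (hX.sub_const _).div_const _
  rw [charFun_apply_real, charFun_apply_real, integral_map hY
    (Continuous.aestronglyMeasurable (by fun_prop)), integral_map hX
    (Continuous.aestronglyMeasurable (by fun_prop)), ← integral_mul_const]
  refine integral_congr_ae (.of_forall fun ω ↦ ?_)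
  simp only [standardised]
  rw [← Complex.exp_add]
  push_cast
  ring_nf

/-- The characteristic function of a standardised variable is the Gaussian one up to the
contribution of the cumulants of order at least three. -/
theorem exists_charFun_standardised_eq [IsProbabilityMeasure μ] (hX : AEMeasurable X μ)
    (h0 : 0 ∈ interior (integrableExpSet X μ)) (hV : 0 < variance X μ) {K q : ℝ} (hK : 0 ≤ K)
    (hq : 0 < q) (hb : ∀ r : ℕ, 1 ≤ r → |cumulant X μ r / r.factorial| ≤ K * q ^ r) {t : ℝ}
    (ht : q * |t / √(variance X μ)| ≤ 1 / 2) :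
    ∃ R : ℂ, ‖R‖ ≤ 2 * K * (q * |t / √(variance X μ)|) ^ 3 ∧
      charFun (μ.map (standardised X μ)) t = Complex.exp (-(t : ℂ) ^ 2 / 2 + R) := by
  set s : ℝ := t / √(variance X μ) with hs
  set f : ℕ → ℂ := fun r ↦ ((cumulant X μ r / r.factorial : ℝ) : ℂ) * (s * Complex.I) ^ r with hf
  have hnorm : ∀ r, ‖f r‖ ≤ K * (q * |s|) ^ r := fun r ↦ by
    have h := norm_cumulant_term_le hK hb r (s * Complex.I)
    rwa [show ‖(s : ℂ) * Complex.I‖ = |s| by simp] at h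
  have hgeo := hasSum_geometric_of_lt_one (r := q * |s|) (by positivity) (by linarith)
  have hsum : Summable f := Summable.of_norm_bounded (hgeo.summable.mul_left K) hnorm
  refine ⟨∑' r, f (r + 3), ?_, ?_⟩
  · have h1 : ‖∑' r, f (r + 3)‖ ≤ K * (q * |s|) ^ 3 * (1 - q * |s|)⁻¹ :=
      tsum_of_norm_bounded (hgeo.mul_left _) fun r ↦ (hnorm (r + 3)).trans_eq (by ring)
    refine h1.trans ?_
    have h2 : (1 - q * |s|)⁻¹ ≤ 2 := inv_le_of_inv_le₀ two_pos (by linarith)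
    calc K * (q * |s|) ^ 3 * (1 - q * |s|)⁻¹ ≤ K * (q * |s|) ^ 3 * 2 := by gcongr
      _ = _ := by ring
  · rw [charFun_map_standardised hX, ← hs, charFun_eq_exp_tsum_cumulant hX h0 hK hq hb (by linarith),
      ← Complex.exp_add]
    congr 1
    change ∑' r, f r + _ = _
    have hfirst : ∑ r ∈ Finset.range 3, f r =
        ((∫ ω, X ω ∂μ : ℝ) : ℂ) * (s * Complex.I) - (t : ℂ) ^ 2 / 2 := by
      have hvs : variance X μ * s ^ 2 = t ^ 2 := by
        rw [hs, div_pow, Real.sq_sqrt hV.le, mul_div_cancel₀ _ hV.ne']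
      have hvs' : (variance X μ : ℂ) * (s : ℂ) ^ 2 = (t : ℂ) ^ 2 := by exact_mod_cast hvs
      simp only [hf, Finset.sum_range_succ, Finset.sum_range_zero, cumulant_zero,
        cumulant_one h0, cumulant_two h0, mul_pow, Complex.I_sq]
      rw [← hvs']
      simp [Nat.factorial]
      ring
    rw [← hsum.sum_add_tsum_nat_add 3, hfirst]
    push_cast
    ring

end Cumulants

/-! ### The zone of control given by the cumulant bounds -/

section Zone

variable {Ω : Type*} [MeasurableSpace Ω] {X : Ω → ℝ} {μ : Measure Ω} {D N A : ℝ}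

/-- The bounds on the first two cumulants determine the signs of the parameters. -/
lemma pos_of_cumulant_bounds [IsProbabilityMeasure μ] (h0 : 0 ∈ interior (integrableExpSet X μ))
    (hb : ∀ r : ℕ, 1 ≤ r →
      |cumulant X μ r| ≤ (r : ℝ) ^ ((r : ℤ) - 2) * A ^ r * (2 * D) ^ (r - 1) * N)
    (hL : 0 < variance X μ ^ (3 / 2 : ℝ) / (N * D ^ 2)) :
    0 < variance X μ ∧ 0 < A ∧ 0 < D ∧ 0 < N ∧ variance X μ ≤ 2 * A ^ 2 * D * N := by
  have hV : 0 < variance X μ := by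
    refine (variance_nonneg X μ).lt_of_ne fun h ↦ ?_
    rw [← h, Real.zero_rpow (by norm_num), zero_div] at hL
    exact hL.false
  have hND : 0 < N * D ^ 2 := by
    by_contra! h
    exact hL.not_ge (div_nonpos_of_nonneg_of_nonpos (Real.rpow_nonneg hV.le _) h)
  have hN : 0 < N := pos_of_mul_pos_left hND (sq_nonneg D)
  have h1 := (abs_nonneg _).trans (hb 1 le_rfl)
  have h2 := (le_abs_self _).trans (hb 2 one_le_two)
  rw [cumulant_two h0] at h2
  norm_num at h1 h2
  have hA0 : 0 ≤ A := nonneg_of_mul_nonneg_left h1 hN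
  have hA : 0 < A := by
    refine hA0.lt_of_ne fun h ↦ ?_
    rw [← h] at h2
    simp at h2
    linarith
  have hD : 0 < D := by
    by_contra! h
    have : A ^ 2 * (2 * D) * N ≤ 0 :=
      mul_nonpos_of_nonpos_of_nonneg
        (mul_nonpos_of_nonneg_of_nonpos (sq_nonneg A) (by linarith)) hN.le
    linarith
  exact ⟨hV, hA, hD, hN, by linarith⟩

/-- Since `r ^ r / r! ≤ e ^ r`, the cumulant bounds are geometric. -/
lemma abs_cumulant_div_factorial_le (hA : 0 < A) (hD : 0 < D) (hN : 0 < N)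
    (hb : ∀ r : ℕ, 1 ≤ r →
      |cumulant X μ r| ≤ (r : ℝ) ^ ((r : ℤ) - 2) * A ^ r * (2 * D) ^ (r - 1) * N)
    (r : ℕ) (hr : 1 ≤ r) :
    |cumulant X μ r / r.factorial| ≤ N / (2 * D) * (2 * Real.exp 1 * A * D) ^ r := by
  have hr1 : (1 : ℝ) ≤ r := by exact_mod_cast hr
  have hfac : (0 : ℝ) < r.factorial := by exact_mod_cast r.factorial_pos
  have h1 : (r : ℝ) ^ ((r : ℤ) - 2) ≤ Real.exp 1 ^ r * r.factorial := by
    calc (r : ℝ) ^ ((r : ℤ) - 2) ≤ (r : ℝ) ^ (r : ℤ) :=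
          zpow_le_zpow_right₀ hr1 (by linarith)
      _ = (r : ℝ) ^ r := zpow_natCast _ _
      _ ≤ Real.exp 1 ^ r * r.factorial := by
        rw [← div_le_iff₀ hfac, ← Real.exp_nat_mul, mul_one]
        exact Real.pow_div_factorial_le_exp _ r.cast_nonneg r
  rw [abs_div, abs_of_pos hfac, div_le_iff₀ hfac]
  calc |cumulant X μ r| ≤ (r : ℝ) ^ ((r : ℤ) - 2) * A ^ r * (2 * D) ^ (r - 1) * N := hb r hr
    _ ≤ Real.exp 1 ^ r * r.factorial * A ^ r * (2 * D) ^ (r - 1) * N := by gcongr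
    _ = N / (2 * D) * (2 * Real.exp 1 * A * D) ^ r * r.factorial := by
      obtain ⟨k, rfl⟩ := Nat.exists_eq_add_of_le' hr
      rw [Nat.add_sub_cancel]
      field_simp
      ring

/-- On a zone of size proportional to `L = Var(X) ^ (3/2) / (N D ^ 2)`, the characteristic function
of the standardised variable is Gaussian up to a factor `exp R` with `R = O(|t| ^ 3 / L)`. -/
theorem exists_charFun_standardised_eq_of_cumulant_bounds [IsProbabilityMeasure μ]
    (hX : AEMeasurable X μ)
    (h0 : 0 ∈ interior (integrableExpSet X μ))
    (hb : ∀ r : ℕ, 1 ≤ r →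
      |cumulant X μ r| ≤ (r : ℝ) ^ ((r : ℤ) - 2) * A ^ r * (2 * D) ^ (r - 1) * N)
    {L : ℝ} (hL : L = variance X μ ^ (3 / 2 : ℝ) / (N * D ^ 2)) (hL0 : 0 < L) {t : ℝ}
    (ht : 4 * (2 * Real.exp 1 * A) ^ 3 * |t| ≤ L) :
    ∃ R : ℂ, ‖R‖ ≤ (2 * Real.exp 1 * A) ^ 3 * |t| ^ 3 / L ∧
      charFun (μ.map (standardised X μ)) t = Complex.exp (-(t : ℂ) ^ 2 / 2 + R) := by
  obtain ⟨hV, hA, hD, hN, hVle⟩ := pos_of_cumulant_bounds h0 hb (hL ▸ hL0)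
  set σ := √(variance X μ) with hσ
  have hσ0 : 0 < σ := Real.sqrt_pos.2 hV
  have hσ2 : σ ^ 2 = variance X μ := Real.sq_sqrt hV.le
  have hσ3 : variance X μ ^ (3 / 2 : ℝ) = σ ^ 3 := by
    rw [hσ, Real.sqrt_eq_rpow, ← Real.rpow_natCast, ← Real.rpow_mul hV.le]
    norm_num
  rw [hσ3] at hL
  have hE : 1 ≤ Real.exp 1 := Real.one_le_exp zero_le_one
  have habs : |t / σ| = |t| / σ := by rw [abs_div, abs_of_pos hσ0]
  have hsmall : 2 * Real.exp 1 * A * D * |t / σ| ≤ 1 / 2 := by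
    rw [hL, le_div_iff₀ (by positivity)] at ht
    rw [habs, ← mul_div_assoc, div_le_iff₀ hσ0]
    -- The zone is small enough because `σ ^ 2 ≤ 2 A ^ 2 D N`.
    have h1 : 4 * (2 * Real.exp 1 * A) ^ 3 * |t| * (N * D ^ 2) ≤ σ * (2 * A ^ 2 * D * N) :=
      ht.trans (by rw [pow_succ', hσ2]; gcongr)
    have h2 : 0 < 2 * A ^ 2 * D * N := by positivity
    have h3 : 4 * (2 * Real.exp 1 * A) ^ 3 * |t| * (N * D ^ 2) =
        8 * Real.exp 1 ^ 2 * (2 * Real.exp 1 * A * D * |t|) * (2 * A ^ 2 * D * N) := by ring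
    rw [h3] at h1
    have h4 := le_of_mul_le_mul_right h1 h2
    have h5 : 0 ≤ 2 * Real.exp 1 * A * D * |t| := by positivity
    nlinarith [one_le_pow₀ hE (n := 2)]
  obtain ⟨R, hR, hφ⟩ := exists_charFun_standardised_eq hX h0 hV (K := N / (2 * D))
    (q := 2 * Real.exp 1 * A * D) (by positivity) (by positivity)
    (abs_cumulant_div_factorial_le hA hD hN hb) hsmall
  refine ⟨R, hR.trans_eq ?_, hφ⟩
  rw [habs, hL]
  field_simp

end Zone

/-! ### Local limit theorems at all admissible scales -/

section Limit

variable {Ω : ℕ → Type*} [∀ n, MeasurableSpace (Ω n)] {P : ∀ n, Measure (Ω n)}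
  [∀ n, IsProbabilityMeasure (P n)] {S : ∀ n, Ω n → ℝ} {D N : ℕ → ℝ} {A : ℝ}

/-- The local limit theorem holds at every scale `1 / a n` with `a n → ∞` and `a n = o(L n)`. -/
theorem tendsto_local_limit_of_cumulant_bounds (hS : ∀ n, AEMeasurable (S n) (P n))
    (hbound : HasUniformCumulantBounds P S D N A)
    (hscale : Tendsto (cumulantScale P S D N) atTop atTop) {a : ℕ → ℝ}
    (ha : Tendsto a atTop atTop)
    (haL : Tendsto (fun n ↦ a n / cumulantScale P S D N n) atTop (𝓝 0)) (y : ℝ) {B : Set ℝ}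
    (hB : IsJordanMeasurable B) :
    Tendsto (fun n ↦ a n * (P n).real {ω | standardised (S n) (P n) ω - y ∈ (a n)⁻¹ • B}) atTop
      (𝓝 (Real.exp (-y ^ 2 / 2) / √(2 * Real.pi) * volume.real B)) := by
  set L := cumulantScale P S D N with hLdef
  set C : ℝ := (2 * Real.exp 1 * A) ^ 3 with hC
  have hL0 : ∀ᶠ n in atTop, 0 < L n := hscale.eventually_gt_atTop 0
  have hC0 : 0 < C := by
    obtain ⟨n, hn⟩ := hL0.exists
    have hA := (pos_of_cumulant_bounds (hbound n).1 (hbound n).2 hn).2.1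
    positivity
  have hY : ∀ n, AEMeasurable (standardised (S n) (P n)) (P n) := fun n ↦
    ((hS n).sub_const _).div_const _
  have hφ : ∀ n, 0 < L n → ∀ t : ℝ, 4 * C * |t| ≤ L n → ∃ R : ℂ, ‖R‖ ≤ C * |t| ^ 3 / L n ∧
      charFun ((P n).map (standardised (S n) (P n))) t = Complex.exp (-(t : ℂ) ^ 2 / 2 + R) :=
    fun n hn t ht ↦ exists_charFun_standardised_eq_of_cumulant_bounds (hS n) (hbound n).1
      (hbound n).2 rfl hn ht
  have hprob : ∀ n, IsProbabilityMeasure ((P n).map (standardised (S n) (P n))) := fun n ↦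
    Measure.isProbabilityMeasure_map (hY n)
  have hlim : ∀ t : ℝ, Tendsto (fun n ↦ charFun ((P n).map (standardised (S n) (P n))) t) atTop
      (𝓝 (Complex.exp (-(t : ℂ) ^ 2 / 2))) := by
    intro t
    -- `R n` is the error term once `t` lies in the zone; its earlier values are irrelevant.
    have hchoose : ∀ n, ∃ R : ℂ, (0 < L n → 4 * C * |t| ≤ L n → ‖R‖ ≤ C * |t| ^ 3 / L n ∧
        charFun ((P n).map (standardised (S n) (P n))) t =
          Complex.exp (-(t : ℂ) ^ 2 / 2 + R)) := fun n ↦ by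
      by_cases h : 0 < L n ∧ 4 * C * |t| ≤ L n
      · obtain ⟨R, hR⟩ := hφ n h.1 t h.2
        exact ⟨R, fun _ _ ↦ hR⟩
      · exact ⟨0, fun h1 h2 ↦ absurd ⟨h1, h2⟩ h⟩
    choose R hR using hchoose
    have hgood := hL0.and (hscale.eventually_ge_atTop (4 * C * |t|))
    have hR0 : Tendsto R atTop (𝓝 0) := by
      refine squeeze_zero_norm' (a := fun n ↦ C * |t| ^ 3 / L n)
        (hgood.mono fun n hn ↦ (hR n hn.1 hn.2).1) (hscale.const_div_atTop _)
    have h1 := (Complex.continuous_exp.tendsto _).comp (hR0.const_add (-(t : ℂ) ^ 2 / 2))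
    rw [add_zero] at h1
    exact h1.congr' (hgood.mono fun n hn ↦ (hR n hn.1 hn.2).2.symm)
  have hdom : ∀ M : ℝ, ∀ᶠ n in atTop, ∀ t : ℝ, |t| ≤ M * a n →
      ‖charFun ((P n).map (standardised (S n) (P n))) t‖ ≤ Real.exp (-t ^ 2 / 4) := by
    intro M
    have hM : Tendsto (fun n ↦ 4 * C * M * (a n / L n)) atTop (𝓝 0) := by
      simpa using haL.const_mul (4 * C * M)
    filter_upwards [hL0, hM.eventually_le_const zero_lt_one] with n hn hMn t ht
    have hzone : 4 * C * |t| ≤ L n := by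
      rw [← mul_div_assoc, div_le_one hn] at hMn
      calc 4 * C * |t| ≤ 4 * C * (M * a n) := by gcongr
        _ ≤ L n := by linarith
    obtain ⟨R, hR, hφR⟩ := hφ n hn t hzone
    rw [hφR, Complex.norm_exp]
    gcongr
    -- The zone is chosen so that the error term takes up at most half of the Gaussian exponent.
    have h1 : C * |t| ^ 3 / L n ≤ t ^ 2 / 4 := by
      rw [div_le_iff₀ hn, ← sq_abs t]
      calc C * |t| ^ 3 = (4 * C * |t|) * (|t| ^ 2 / 4) := by ring
        _ ≤ L n * (|t| ^ 2 / 4) := by gcongr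
        _ = _ := mul_comm _ _
    have h2 : (-(t : ℂ) ^ 2 / 2 + R).re = -t ^ 2 / 2 + R.re := by
      have : (-(t : ℂ) ^ 2 / 2) = ((-t ^ 2 / 2 : ℝ) : ℂ) := by push_cast; ring
      rw [this, Complex.add_re, Complex.ofReal_re]
    rw [h2]
    linarith [Complex.re_le_norm R]
  refine (tendsto_local_limit ha hlim hdom y hB).congr' ?_
  filter_upwards [ha.eventually_gt_atTop 0] with n hn
  rw [Measure.real, Measure.real, Measure.map_apply_of_aemeasurable (hY n)]
  · rfl
  · exact (hB.2.1.const_smul₀ (a n)⁻¹).preimage (measurable_id.sub_const y)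

end Limit

/-! ### The two ranges of scales -/

theorem mainTheorem10 {Ω : ℕ → Type*} [∀ n, MeasurableSpace (Ω n)]
    (P : ∀ n, Measure (Ω n)) [∀ n, IsProbabilityMeasure (P n)]
    (S : ∀ n, Ω n → ℝ) (hS : ∀ n, AEMeasurable (S n) (P n))
    (D N : ℕ → ℝ) (A : ℝ)
    (hbound : HasUniformCumulantBounds P S D N A)
    (hscale : Tendsto (cumulantScale P S D N) atTop atTop)
    (hDN : D =o[atTop] N) :
    (∀ δ ∈ Set.Ioo (0 : ℝ) 1, ∀ y : ℝ, ∀ B : Set ℝ, IsJordanMeasurable B → 0 < volume B →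
      Tendsto
        (fun n => cumulantScale P S D N n ^ δ *
          (P n).real {ω | standardised (S n) (P n) ω - y ∈ (cumulantScale P S D N n ^ (-δ)) • B})
        atTop (𝓝 (Real.exp (-y ^ 2 / 2) / √(2 * Real.pi) * volume.real B))) ∧
    (0 < liminf (fun n => variance (S n) (P n) / (N n * D n)) atTop →
      ∀ γ ∈ Set.Ioo (0 : ℝ) (1 / 2), ∀ y : ℝ, ∀ B : Set ℝ, IsJordanMeasurable B → 0 < volume B →
        Tendsto
          (fun n => (N n / D n) ^ γ *
            (P n).real {ω | standardised (S n) (P n) ω - y ∈ ((D n / N n) ^ γ) • B})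
          atTop (𝓝 (Real.exp (-y ^ 2 / 2) / √(2 * Real.pi) * volume.real B))) := by
  have hL0 : ∀ᶠ n in atTop, 0 < cumulantScale P S D N n := hscale.eventually_gt_atTop 0
  have hpos : ∀ᶠ n in atTop, 0 < variance (S n) (P n) ∧ 0 < D n ∧ 0 < N n := hL0.mono fun n hn ↦ by
    obtain ⟨hV, -, hD, hN, -⟩ := pos_of_cumulant_bounds (hbound n).1 (hbound n).2 hn
    exact ⟨hV, hD, hN⟩
  refine ⟨fun δ hδ y B hB _ ↦ ?_, fun hliminf γ hγ y B hB _ ↦ ?_⟩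
  · -- The scale `a n = L n ^ δ`.
    have ha : Tendsto (fun n ↦ cumulantScale P S D N n ^ δ) atTop atTop :=
      (tendsto_rpow_atTop hδ.1).comp hscale
    have haL : Tendsto (fun n ↦ cumulantScale P S D N n ^ δ / cumulantScale P S D N n) atTop
        (𝓝 0) := by
      refine ((tendsto_rpow_neg_atTop (sub_pos.2 hδ.2)).comp hscale).congr' (hL0.mono fun n hn ↦ ?_)
      rw [Function.comp_apply, neg_sub, Real.rpow_sub_one hn.ne']
    refine (tendsto_local_limit_of_cumulant_bounds hS hbound hscale ha haL y hB).congr'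
      (hL0.mono fun n hn ↦ ?_)
    simp only [Real.rpow_neg hn.le]
  · -- The scale `a n = (N n / D n) ^ γ`.
    have hratio : Tendsto (fun n ↦ N n / D n) atTop atTop := by
      have h1 : Tendsto (fun n ↦ D n / N n) atTop (𝓝[>] 0) :=
        tendsto_nhdsWithin_iff.2 ⟨hDN.tendsto_div_nhds_zero,
          hpos.mono fun n hn ↦ div_pos hn.2.1 hn.2.2⟩
      exact h1.inv_tendsto_nhdsGT_zero.congr fun n ↦ inv_div _ _
    have ha : Tendsto (fun n ↦ (N n / D n) ^ γ) atTop atTop :=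
      (tendsto_rpow_atTop hγ.1).comp hratio
    obtain ⟨c, hc0, hc⟩ := exists_between hliminf
    have hev := eventually_lt_of_lt_liminf hc
      (isBoundedUnder_of_eventually_ge (a := 0)
        (hpos.mono fun n hn ↦ div_nonneg hn.1.le (mul_pos hn.2.2 hn.2.1).le))
    have haL : Tendsto (fun n ↦ (N n / D n) ^ γ / cumulantScale P S D N n) atTop (𝓝 0) := by
      have hlim : Tendsto (fun n ↦ (c ^ (3 / 2 : ℝ))⁻¹ * (N n / D n) ^ (-(1 / 2 - γ))) atTop
          (𝓝 0) := by
        simpa using ((tendsto_rpow_neg_atTop (sub_pos.2 hγ.2)).comp hratio).const_mul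
          (c ^ (3 / 2 : ℝ))⁻¹
      refine squeeze_zero' ?_ ?_ hlim
      · filter_upwards [hL0, hpos] with n hn hp
        exact div_nonneg (Real.rpow_nonneg (div_pos hp.2.2 hp.2.1).le _) hn.le
      · filter_upwards [hL0, hpos, hev] with n hn ⟨hV, hD, hN⟩ hcn
        have hx : 0 < N n / D n := div_pos hN hD
        -- The bound `Var ≥ c N D` gives `L ≥ c ^ (3/2) (N / D) ^ (1/2)`.
        have hL : c ^ (3 / 2 : ℝ) * (N n / D n) ^ (1 / 2 : ℝ) ≤ cumulantScale P S D N n := by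
          rw [cumulantScale, le_div_iff₀ (by positivity)]
          rw [lt_div_iff₀ (by positivity)] at hcn
          calc c ^ (3 / 2 : ℝ) * (N n / D n) ^ (1 / 2 : ℝ) * (N n * D n ^ 2)
              = (c * (N n * D n)) ^ (3 / 2 : ℝ) := by
                have e1 : c * (N n * D n) = c * ((N n / D n) * D n ^ (2 : ℝ)) := by
                  rw [Real.rpow_two]; field_simp
                have e2 : (N n / D n) ^ (3 / 2 : ℝ) = (N n / D n) ^ (1 / 2 : ℝ) * (N n / D n) := by
                  rw [← Real.rpow_add_one hx.ne']; norm_num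
                rw [e1, Real.mul_rpow hc0.le (by positivity), Real.mul_rpow hx.le (by positivity),
                  ← Real.rpow_mul hD.le, e2, show (2 : ℝ) * (3 / 2) = (3 : ℕ) by norm_num,
                  Real.rpow_natCast]
                field_simp
            _ ≤ _ := Real.rpow_le_rpow (by positivity) hcn.le (by norm_num)
        calc (N n / D n) ^ γ / cumulantScale P S D N n
            ≤ (N n / D n) ^ γ / (c ^ (3 / 2 : ℝ) * (N n / D n) ^ (1 / 2 : ℝ)) := by gcongr
          _ = (c ^ (3 / 2 : ℝ))⁻¹ * (N n / D n) ^ (-(1 / 2 - γ)) := by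
            rw [neg_sub, Real.rpow_sub hx]
            field_simp
    refine (tendsto_local_limit_of_cumulant_bounds hS hbound hscale ha haL y hB).congr'
      (hpos.mono fun n hn ↦ ?_)
    rw [← Real.inv_rpow (div_pos hn.2.2 hn.2.1).le, inv_div]
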